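/- **Theorem 9.3 (= Theorem 1.4, extension of Dedekind's theorem).** Let $G$ be a finite group and let $H$ be an abelian subgroup of $G$. Let $\mathbb{C}[x_g]$ be the polynomial ring over $\mathbb{C}$ in independent commuting variables $x_g$, $g\in G$; let $\mathbb{C}[x_g]G$ be the group algebra of $G$ over $\mathbb{C}[x_g]$, with unit $1_G$, and let $\mathbb{C}[x_g]H\subseteq \mathbb{C}[x_g]G$ be the group algebra of $H$, a commutative subring. Put $\mathfrak{X}_G=\sum_{g\in G}x_g\,g\in\mathbb{C}[x_g]G$ and let $\Theta(G)=\det\left(x_{gh^{-1}}\right)_{g,h\in G}\in\mathbb{C}[x_g]$ be the group determinant. If a ring $A$ is a free right module of rank $m$ over a commutative subring $B$, with basis $e_1,\dots,e_m$, then $\mathrm{Sdet}_{\mathrm{M}(1,A)}^{B}(a):=\det(b_{ij})\in B$ for $a\in A=\mathrm{M}(1,A)$, where $a e_j=\sum_i e_i b_{ij}$ with $b_{ij}\in B$; this does not depend on the basis. Let $$\Theta(G:H):=\mathrm{Sdet}_{\mathrm{M}(1,\mathbb{C}[x_g]G)}^{\mathbb{C}[x_g]H}(\mathfrak{X}_G)\in\mathbb{C}[x_g]H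 .$$ Let $\widehat G$ be a complete set of inequivalent irreducible (matrix) representations of $G$ over $\mathbb{C}$, each $\varphi\in\widehat G$ being extended by $\varphi\left(\sum_g c_g g\right)=\sum_g c_g\varphi(g)$ with $c_g\in\mathbb{C}[x_g]$, and let $\widehat H$ be the set of all homomorphisms $\chi\colon H\to\mathbb{C}^{\times}$, each extended by $\chi\left(\sum_h c_h h\right)=\sum_h c_h\chi(h)$. Identify $c\in\mathbb{C}[x_g]$ with $c\,1_G$. Then, in $\mathbb{C}[x_g]G$, $$\Theta(G)\,1_G=\prod_{\varphi\in\widehat G}\det\left(\varphi(\mathfrak{X}_G)\right)^{\deg\varphi}=\prod_{\chi\in\widehat H}\chi\left(\Theta(G:H)\right),$$ where the determinants are taken over $\mathbb{C}[x_g]H$. The last equality also holds when each $\chi$ is extended instead by $\chi\left(\sum_h c_h h\right)=\sum_h \chi(h)\,c_h\,h$. -/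

import Mathlib

open scoped Matrix

/-! ### Left regular representations and Study-type determinants -/

section StudyDeterminant

variable {A B : Type*} [Ring A] [CommRing B] [Module Bᵐᵒᵖ A]

/-- The left regular representation `L : M(r, A) → M(m, M(r, B))` attached to a basis `e` of `A`
as a right `B`-module (right `B`-modules are modules over `Bᵐᵒᵖ`): the blocks `L(a) i j ∈ M(r, B)`
are characterised by `a (e_j ⊗ I) = ∑ i, (e_i ⊗ I) (L(a) i j)`, i.e. entrywise by
`a k l * e_j = ∑ i, e_i * (L(a) i j) k l`. -/
noncomputable def leftRegular {κ : Type*} (e : Module.Basis κ Bᵐᵒᵖ A) {r : Type*}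
    (a : Matrix r r A) : Matrix κ κ (Matrix r r B) :=
  Matrix.of fun i j => Matrix.of fun k l => (e.repr (a k l * e j) i).unop

/-- The Study-type determinant `Sdet : M(r, A) → B`: the determinant of the left regular
representation, its blocks being flattened (`Matrix.comp`) to one square matrix over `B`. -/
noncomputable def studyDet {κ : Type*} [Fintype κ] [DecidableEq κ] (e : Module.Basis κ Bᵐᵒᵖ A)
    {r : Type*} [Fintype r] [DecidableEq r] (a : Matrix r r A) : B :=
  (Matrix.comp κ κ r r B (leftRegular e a)).det

end StudyDeterminant

/-! ### Group determinants -/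

/-- `ℂ[x_g]`, the polynomial ring in variables indexed by the elements of `G`. -/
abbrev PolyRing (G : Type*) : Type _ := MvPolynomial G ℂ

/-- `ℂ[x_g]K`, the group algebra of `K` over the polynomial ring `ℂ[x_g ; g ∈ G]`. -/
abbrev PolyGroupAlg (G K : Type*) : Type _ := MonoidAlgebra (PolyRing G) K

section GroupDeterminant

variable {G : Type*} [Group G]

/-- The group determinant `Θ(G) = det (x_{g h⁻¹})_{g, h ∈ G}`. -/
noncomputable def groupDet (G : Type*) [Group G] [Fintype G] [DecidableEq G] : PolyRing G :=
  (Matrix.of fun g h : G => (MvPolynomial.X (g * h⁻¹) : PolyRing G)).det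

/-- The general element `𝔛_G = ∑ g, x_g g` of `ℂ[x_g]G`. -/
noncomputable def generalElement (G : Type*) [Group G] [Fintype G] : PolyGroupAlg G G :=
  ∑ g : G, MonoidAlgebra.single g (MvPolynomial.X g)

/-- The inclusion `ℂ[x_g]H ⊆ ℂ[x_g]G`. -/
noncomputable def subgroupAlgIncl (H : Subgroup G) : PolyGroupAlg G H →+* PolyGroupAlg G G :=
  MonoidAlgebra.mapDomainRingHom (PolyRing G) H.subtype

/-- `ℂ[x_g]H` is a commutative ring when `H` is abelian. -/
noncomputable instance subgroupAlgCommRing (H : Subgroup G) [IsMulCommutative H] :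
    CommRing (PolyGroupAlg G H) where
  __ := (inferInstance : Ring (PolyGroupAlg G H))
  mul_comm := by
    let _ : CommMonoid H := { (inferInstance : Monoid H) with mul_comm := mul_comm' }
    exact (MonoidAlgebra.commRing (R := PolyRing G) (M := H)).mul_comm

/-- `ℂ[x_g]G` as a right module over its subring `ℂ[x_g]H`, by multiplication on the right. -/
noncomputable instance subgroupAlgRightModule (H : Subgroup G) :
    Module (PolyGroupAlg G H)ᵐᵒᵖ (PolyGroupAlg G G) :=
  Module.compHom (PolyGroupAlg G G) (subgroupAlgIncl H).op

theorem subgroupAlg_op_smul (H : Subgroup G) (b : PolyGroupAlg G H) (a : PolyGroupAlg G G) :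
    MulOpposite.op b • a = a * subgroupAlgIncl H b := rfl

/-- Left coset representatives of `H` form a basis of `ℂ[x_g]G` as a right `ℂ[x_g]H`-module, so
that this right module is indeed free, of rank `[G : H]`. -/
theorem exists_cosetBasis (H : Subgroup G) :
    ∃ e : Module.Basis (G ⧸ H) (PolyGroupAlg G H)ᵐᵒᵖ (PolyGroupAlg G G),
      ∀ q, e q = MonoidAlgebra.single q.out 1 := by
  classical
  have hcoeff : ∀ (q p : G ⧸ H) (b : PolyGroupAlg G H) (h : H),
      (MonoidAlgebra.single q.out (1 : PolyRing G) * subgroupAlgIncl H b).coeff (p.out * h) =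
        if q = p then b.coeff h else 0 := by
    intro q p b h
    induction b using MonoidAlgebra.induction_linear with
    | zero => simp
    | add f g hf hg =>
      rw [map_add, mul_add, MonoidAlgebra.coeff_add, Finsupp.add_apply, hf, hg]
      split_ifs <;> simp
    | single k r =>
      have h1 : subgroupAlgIncl H (MonoidAlgebra.single k r) =
          MonoidAlgebra.single (k : G) r := by
        simp [subgroupAlgIncl]
      rw [h1, MonoidAlgebra.single_mul_single, one_mul, MonoidAlgebra.coeff_single,
        MonoidAlgebra.coeff_single, Finsupp.single_apply, Finsupp.single_apply]
      by_cases hqp : q = p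
      · subst hqp
        simp
      · rw [if_neg, if_neg hqp]
        intro h2
        apply hqp
        have h3 : ((q.out * (k : G) : G) : G ⧸ H) = ((p.out * (h : G) : G) : G ⧸ H) := by rw [h2]
        rwa [QuotientGroup.mk_mul_of_mem _ k.2, QuotientGroup.mk_mul_of_mem _ h.2,
          QuotientGroup.out_eq', QuotientGroup.out_eq'] at h3
  have hli : LinearIndependent (PolyGroupAlg G H)ᵐᵒᵖ
      fun q : G ⧸ H => (MonoidAlgebra.single q.out 1 : PolyGroupAlg G G) := by
    rw [linearIndependent_iff']
    intro s c hc p hp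
    apply MulOpposite.unop_injective
    apply MonoidAlgebra.ext
    ext1 h
    have h1 := congrArg (fun a : PolyGroupAlg G G => a.coeff (p.out * h)) hc
    simp only [MonoidAlgebra.coeff_sum, Finsupp.finsetSum_apply, MonoidAlgebra.coeff_zero,
      Finsupp.zero_apply] at h1
    have h2 : ∀ q ∈ s, (c q • (MonoidAlgebra.single q.out 1 : PolyGroupAlg G G)).coeff
        (p.out * h) = if q = p then (c q).unop.coeff h else 0 :=
      fun q _ => hcoeff q p (c q).unop h
    rw [Finset.sum_congr rfl h2] at h1
    simpa [hp] using h1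
  have hspan : ⊤ ≤ Submodule.span (PolyGroupAlg G H)ᵐᵒᵖ
      (Set.range fun q : G ⧸ H => (MonoidAlgebra.single q.out 1 : PolyGroupAlg G G)) := by
    intro a _
    induction a using MonoidAlgebra.induction_linear with
    | zero => exact Submodule.zero_mem _
    | add f g hf hg => exact Submodule.add_mem _ (hf trivial) (hg trivial)
    | single g r =>
      obtain ⟨k, hk⟩ := QuotientGroup.mk_out_eq_mul H g
      have h1 : (MonoidAlgebra.single g r : PolyGroupAlg G G) =
          MulOpposite.op (MonoidAlgebra.single k⁻¹ r : PolyGroupAlg G H) •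
            (MonoidAlgebra.single (g : G ⧸ H).out 1 : PolyGroupAlg G G) := by
        rw [subgroupAlg_op_smul, hk]
        simp [subgroupAlgIncl, MonoidAlgebra.single_mul_single]
      rw [h1]
      exact Submodule.smul_mem _ _ (Submodule.subset_span ⟨_, rfl⟩)
  exact ⟨Module.Basis.mk hli hspan, fun q => Module.Basis.mk_apply hli hspan q⟩

/-- The extension `∑ g, c_g g ↦ ∑ g, c_g φ(g)` to `ℂ[x_g]G` of a matrix representation `φ` of
`G`. -/
noncomputable def extendRep {n : ℕ} (φ : G →* Matrix (Fin n) (Fin n) ℂ) :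
    PolyGroupAlg G G →ₐ[PolyRing G] Matrix (Fin n) (Fin n) (PolyRing G) :=
  MonoidAlgebra.lift (PolyRing G) _ G
    (((MvPolynomial.C : ℂ →+* PolyRing G).mapMatrix :
      Matrix (Fin n) (Fin n) ℂ →+* Matrix (Fin n) (Fin n) (PolyRing G)).toMonoidHom.comp φ)

/-- The extension `∑ h, c_h h ↦ ∑ h, c_h χ(h)` to `ℂ[x_g]H` of a character `χ` of `H`. -/
noncomputable def extendChar {H : Subgroup G} (χ : H →* ℂˣ) :
    PolyGroupAlg G H →ₐ[PolyRing G] PolyRing G :=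
  MonoidAlgebra.lift (PolyRing G) _ H
    (((MvPolynomial.C : ℂ →+* PolyRing G) : ℂ →* PolyRing G).comp ((Units.coeHom ℂ).comp χ))

/-- The twist `∑ h, c_h h ↦ ∑ h, χ(h) c_h h` of `ℂ[x_g]H` by a character `χ` of `H`. -/
noncomputable def twistChar {H : Subgroup G} (χ : H →* ℂˣ) (b : PolyGroupAlg G H) :
    PolyGroupAlg G H :=
  b.coeff.sum fun h c => MonoidAlgebra.single h (MvPolynomial.C (χ h : ℂ) * c)

/-- The representation on `ℂⁿ` given by a matrix representation. -/
noncomputable def matRep {n : ℕ} (φ : G →* Matrix (Fin n) (Fin n) ℂ) :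
    Representation ℂ G (Fin n → ℂ) :=
  ((Matrix.toLinAlgEquiv' : Matrix (Fin n) (Fin n) ℂ ≃ₐ[ℂ] _) : _ →* _).comp φ

/-- `φ` is a complete set of inequivalent irreducible complex (matrix) representations of `G`:
a choice of `Ĝ`. -/
structure IsCompleteIrreps {ι : Type*} (d : ι → ℕ)
    (φ : ∀ i, G →* Matrix (Fin (d i)) (Fin (d i)) ℂ) : Prop where
  irreducible : ∀ i, (matRep (φ i)).IsIrreducible
  inequivalent : ∀ i j, i ≠ j → IsEmpty ((matRep (φ i)).Equiv (matRep (φ j)))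
  complete : ∀ (n : ℕ) (σ : G →* Matrix (Fin n) (Fin n) ℂ), (matRep σ).IsIrreducible →
    ∃ i, Nonempty ((matRep σ).Equiv (matRep (φ i)))

end GroupDeterminant

/-! Each product formula comes from an invertible complex matrix. The matrix coefficients `φ i g k
l` form a matrix `P` with `P * (x_{gh⁻¹}) = D * P`, where `D` is block diagonal with blocks `φ i
(𝔛_G) ⊗ 1`. Schur orthogonality makes the rows of `P` independent and semisimplicity of `ℂ[G]` the
columns, so the determinants agree (`IsCompleteIrreps.groupDet_eq_prod`).

For `H`, `Θ(G:H)` is the determinant of left multiplication by `𝔛_G` over `ℂ[x_g]H`, so its norm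
down to `ℂ[x_g]` is the determinant over `ℂ[x_g]`, namely `Θ(G)` (`norm_studyDet`). The character
table of `H` diagonalizes multiplication in `ℂ[x_g]H`, so the norm is the product of the values of
the characters (`norm_eq_prod_extendChar`). The twisted product has that same value under every
character, and characters separate elements (`prod_twistChar`). -/

/-! ### Change of basis by matrices over a field -/

theorem Matrix.isUnit_det_map_submatrix {m n k R : Type*} [Fintype m] [DecidableEq m] [Field k]
    [CommRing R] (f : k →+* R) (e : m ≃ n) {P : Matrix m n k} (hP : LinearIndependent k P.row) :
    IsUnit ((P.map f).submatrix id e).det := by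
  have hrow : LinearIndependent k (P.submatrix id e).row :=
    hP.map' (LinearEquiv.funCongrLeft k k e).toLinearMap (LinearEquiv.ker _)
  have hu : IsUnit (P.submatrix id e).det :=
    (Matrix.isUnit_iff_isUnit_det _).1 (Matrix.linearIndependent_rows_iff_isUnit.1 hrow)
  have := hu.map f
  rwa [RingHom.map_det] at this

theorem Matrix.mulVec_map_injective {m n k R : Type*} [Fintype m] [Fintype n] [Field k]
    [CommRing R] (f : k →+* R) (hcard : Fintype.card m = Fintype.card n)
    {P : Matrix m n k} (hP : LinearIndependent k P.row) :
    Function.Injective (P.map f).mulVec := by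
  classical
  let e : m ≃ n := Fintype.equivOfCardEq hcard
  have hu := Matrix.isUnit_det_map_submatrix f e hP
  intro u v huv
  have h : (P.map f).submatrix id e *ᵥ (u ∘ e) = (P.map f).submatrix id e *ᵥ (v ∘ e) := by
    simpa [Matrix.submatrix_mulVec_equiv, Function.comp_assoc] using huv
  have h1 := Matrix.mulVec_injective_of_isUnit ((Matrix.isUnit_iff_isUnit_det _).2 hu) h
  exact e.surjective.injective_comp_right h1

/-- A similarity between matrices with different index types: a bijection makes `P` square, and its
nonzero determinant stays a unit in `R`, so it cancels. -/
theorem Matrix.det_eq_det_of_mul_eq_mul {m n k R : Type*} [Fintype m] [DecidableEq m] [Fintype n]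
    [DecidableEq n] [Field k] [CommRing R] (f : k →+* R) (hcard : Fintype.card m = Fintype.card n)
    {P : Matrix m n k} (hP : LinearIndependent k P.row) {M : Matrix n n R} {D : Matrix m m R}
    (h : P.map f * M = D * P.map f) : M.det = D.det := by
  let e : m ≃ n := Fintype.equivOfCardEq hcard
  have h' : (P.map f).submatrix id e * M.submatrix e e = D * (P.map f).submatrix id e := by
    rw [Matrix.submatrix_mul_equiv, h]
    exact Matrix.submatrix_mul _ _ _ _ _ Function.bijective_id
  have h2 := congrArg Matrix.det h'
  rw [Matrix.det_mul, Matrix.det_mul, Matrix.det_submatrix_equiv_self, mul_comm] at h2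
  exact (Matrix.isUnit_det_map_submatrix f e hP).mul_right_cancel h2

/-! ### Schur's lemma and orthogonality of matrix coefficients -/

section Schur

variable {G : Type*} [Group G]

/-- The intertwining map given by a matrix. -/
noncomputable def matrixIntertwiningMap {m n : ℕ} {φ : G →* Matrix (Fin m) (Fin m) ℂ}
    {ψ : G →* Matrix (Fin n) (Fin n) ℂ} (S : Matrix (Fin m) (Fin n) ℂ)
    (hS : ∀ g, φ g * S = S * ψ g) : (matRep ψ).IntertwiningMap (matRep φ) where
  toLinearMap := Matrix.toLin' S
  isIntertwining' g := by
    refine LinearMap.ext fun v => ?_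
    change S *ᵥ (ψ g *ᵥ v) = φ g *ᵥ (S *ᵥ v)
    rw [Matrix.mulVec_mulVec, Matrix.mulVec_mulVec, hS]

theorem eq_zero_of_intertwines {m n : ℕ} {φ : G →* Matrix (Fin m) (Fin m) ℂ}
    {ψ : G →* Matrix (Fin n) (Fin n) ℂ} (hφ : (matRep φ).IsIrreducible)
    (hψ : (matRep ψ).IsIrreducible) (hne : IsEmpty ((matRep ψ).Equiv (matRep φ)))
    (S : Matrix (Fin m) (Fin n) ℂ) (hS : ∀ g, φ g * S = S * ψ g) : S = 0 := by
  have h : matrixIntertwiningMap S hS = 0 := Subsingleton.elim _ _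
  have h1 : Matrix.toLin' S = 0 := congrArg (fun f => f.toLinearMap) h
  simpa using h1

theorem eq_smul_one_of_intertwines {n : ℕ} {φ : G →* Matrix (Fin n) (Fin n) ℂ}
    (hφ : (matRep φ).IsIrreducible) (S : Matrix (Fin n) (Fin n) ℂ)
    (hS : ∀ g, φ g * S = S * φ g) : ∃ c : ℂ, S = c • 1 := by
  obtain ⟨c, hc⟩ := (Representation.IsIrreducible.algebraMap_intertwiningMap_bijective_of_isAlgClosed
    (ρ := matRep φ)).2 (matrixIntertwiningMap S hS)
  refine ⟨c, ?_⟩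
  have h1 : c • LinearMap.id = Matrix.toLin' S := congrArg (fun f => f.toLinearMap) hc
  apply Matrix.toLin'.injective
  rw [← h1]
  simp

variable [Fintype G]

theorem average_intertwines {m n : ℕ} (φ : G →* Matrix (Fin m) (Fin m) ℂ)
    (ψ : G →* Matrix (Fin n) (Fin n) ℂ) (T : Matrix (Fin m) (Fin n) ℂ) (h : G) :
    φ h * (∑ g, φ g * T * ψ g⁻¹) = (∑ g, φ g * T * ψ g⁻¹) * ψ h := by
  rw [Matrix.mul_sum, Matrix.sum_mul]
  refine Fintype.sum_equiv (Equiv.mulLeft h) _ _ fun g => ?_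
  simp only [Equiv.coe_mulLeft, mul_inv_rev, Matrix.mul_assoc, ← map_mul, inv_mul_cancel_right]
  rw [map_mul, Matrix.mul_assoc]

theorem sum_apply_mul_inv_apply {m n : ℕ} (φ : G →* Matrix (Fin m) (Fin m) ℂ)
    (ψ : G →* Matrix (Fin n) (Fin n) ℂ) (k l : Fin m) (p q : Fin n) :
    ∑ g, φ g k l * ψ g⁻¹ p q = (∑ g, φ g * Matrix.single l p (1 : ℂ) * ψ g⁻¹) k q := by
  simp [Matrix.sum_apply, Matrix.mul_apply, Matrix.single_apply, ite_and]

theorem sum_apply_mul_inv_apply_of_isEmpty {m n : ℕ} {φ : G →* Matrix (Fin m) (Fin m) ℂ}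
    {ψ : G →* Matrix (Fin n) (Fin n) ℂ} (hφ : (matRep φ).IsIrreducible)
    (hψ : (matRep ψ).IsIrreducible) (hne : IsEmpty ((matRep ψ).Equiv (matRep φ)))
    (k l : Fin m) (p q : Fin n) : ∑ g, φ g k l * ψ g⁻¹ p q = 0 := by
  rw [sum_apply_mul_inv_apply, eq_zero_of_intertwines hφ hψ hne _ (average_intertwines φ ψ _)]
  rfl

/-- By Schur's lemma the average of a matrix unit is a scalar matrix; comparing traces gives the
scalar. -/
theorem sum_apply_mul_inv_apply_self {n : ℕ} {φ : G →* Matrix (Fin n) (Fin n) ℂ}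
    (hφ : (matRep φ).IsIrreducible) (k l p q : Fin n) :
    ∑ g, φ g k l * φ g⁻¹ p q = if k = q ∧ l = p then (Fintype.card G : ℂ) / n else 0 := by
  obtain ⟨c, hc⟩ := eq_smul_one_of_intertwines hφ _ (average_intertwines φ φ (Matrix.single l p 1))
  have htr := congrArg Matrix.trace hc
  have hn : (n : ℂ) ≠ 0 := by
    have := k.pos
    exact_mod_cast this.ne'
  have h1 : ∀ g : G, (φ g * Matrix.single l p 1 * φ g⁻¹).trace = if l = p then 1 else 0 := by
    intro g
    rw [Matrix.trace_mul_cycle, ← map_mul]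
    by_cases h : l = p <;> simp [h, Matrix.trace_single_eq_of_ne]
  rw [Matrix.trace_sum, Finset.sum_congr rfl fun g _ => h1 g] at htr
  have hc' : c = if l = p then (Fintype.card G : ℂ) / n else 0 := by
    rw [Matrix.trace_smul, Matrix.trace_one] at htr
    split_ifs with h
    · simp [h] at htr
      field_simp
      exact htr.symm
    · simpa [h, hn] using htr.symm
  rw [sum_apply_mul_inv_apply, hc, hc']
  by_cases h : k = q <;> by_cases h' : l = p <;> simp [h, h']

variable {ι : Type*} {d : ι → ℕ} {φ : ∀ i, G →* Matrix (Fin (d i)) (Fin (d i)) ℂ}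

/-- The matrix coefficients of the representations `φ i`, one for each row. -/
def coeffMatrix (φ : ∀ i, G →* Matrix (Fin (d i)) (Fin (d i)) ℂ) :
    Matrix (Σ i, Fin (d i) × Fin (d i)) G ℂ :=
  Matrix.of fun x g => φ x.1 g x.2.1 x.2.2

theorem IsCompleteIrreps.linearIndependent_coeffMatrix (hφ : IsCompleteIrreps d φ) :
    LinearIndependent ℂ (coeffMatrix φ).row := by
  rw [linearIndependent_iff']
  rintro s c hc ⟨j, q, p⟩ hj
  have h1 : ∀ g, ∑ x ∈ s, c x * φ x.1 g x.2.1 x.2.2 = 0 := by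
    intro g
    simpa [coeffMatrix] using congrFun hc g
  -- Pairing with `φ j g⁻¹ p q`, indices swapped, isolates the coefficient at `⟨j, q, p⟩`.
  have h2 : ∑ x ∈ s, c x * ∑ g, φ x.1 g x.2.1 x.2.2 * φ j g⁻¹ p q = 0 := by
    simp_rw [Finset.mul_sum]
    rw [Finset.sum_comm]
    refine Finset.sum_eq_zero fun g _ => ?_
    simp_rw [← mul_assoc]
    rw [← Finset.sum_mul, h1, zero_mul]
  rw [Finset.sum_eq_single_of_mem _ hj] at h2
  · rw [sum_apply_mul_inv_apply_self (hφ.irreducible j)] at h2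
    have hn : (d j : ℂ) ≠ 0 := by
      have := p.pos
      exact_mod_cast this.ne'
    simpa [hn] using h2
  · rintro ⟨i, k, l⟩ - hne
    by_cases hij : i = j
    · subst hij
      dsimp only
      rw [sum_apply_mul_inv_apply_self (hφ.irreducible i), if_neg, mul_zero]
      rintro ⟨rfl, rfl⟩
      exact hne rfl
    · rw [sum_apply_mul_inv_apply_of_isEmpty (hφ.irreducible i) (hφ.irreducible j)
        (hφ.inequivalent j i (Ne.symm hij)), mul_zero]

end Schur

theorem Matrix.det_blockDiagonal' {ι R : Type*} {β : ι → Type*} [Fintype ι] [DecidableEq ι]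
    [∀ i, Fintype (β i)] [∀ i, DecidableEq (β i)] [CommRing R] (M : ∀ i, Matrix (β i) (β i) R) :
    (Matrix.blockDiagonal' M).det = ∏ i, (M i).det := by
  -- An arbitrary order, needed only to speak of block triangularity.
  let _ : LinearOrder ι := LinearOrder.lift' (Fintype.equivFin ι) (Fintype.equivFin ι).injective
  rw [Matrix.BlockTriangular.det_fintype (Matrix.blockTriangular_blockDiagonal' M)]
  refine Finset.prod_congr rfl fun i _ => ?_
  rw [← Matrix.det_submatrix_equiv_self (Equiv.sigmaSubtype i).symm]
  congr 1
  ext x y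
  exact Matrix.blockDiagonal'_apply_eq M i x y

/-! ### Completeness of the irreducibles and Frobenius's factorization -/

section Frobenius

variable {G : Type*} [Group G]

theorem Representation.Equiv.isIrreducible {k V W : Type*} [Field k] [AddCommGroup V] [Module k V]
    [AddCommGroup W] [Module k W] {ρ : Representation k G V} {σ : Representation k G W}
    (f : ρ.Equiv σ) (hρ : ρ.IsIrreducible) : σ.IsIrreducible := by
  rw [Representation.irreducible_iff_isSimpleModule_asModule] at hρ ⊢
  exact IsSimpleModule.congr
    (LinearEquiv.ofBijective (Representation.IntertwiningMap.equivLinearMapAsModule ρ σ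
      f.toIntertwiningMap) f.toLinearEquiv.bijective).symm

theorem Representation.asAlgebraHom_ofModule' {k M : Type*} [Field k] [AddCommGroup M]
    [Module k M] [Module (MonoidAlgebra k G) M] [IsScalarTower k (MonoidAlgebra k G) M]
    (x : MonoidAlgebra k G) (m : M) :
    (Representation.ofModule' (k := k) (G := G) M).asAlgebraHom x m = x • m := by
  have h : (Representation.ofModule' (k := k) (G := G) M).asAlgebraHom = Algebra.lsmul k k M :=
    (MonoidAlgebra.lift k (Module.End k M) G).apply_symm_apply _
  rw [h]
  rfl

theorem Representation.isIrreducible_ofModule' {k M : Type*} [Field k] [AddCommGroup M]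
    [Module k M] [Module (MonoidAlgebra k G) M] [IsScalarTower k (MonoidAlgebra k G) M]
    [IsSimpleModule (MonoidAlgebra k G) M] :
    (Representation.ofModule' (k := k) (G := G) M).IsIrreducible := by
  let ρ := Representation.ofModule' (k := k) (G := G) M
  rw [Representation.irreducible_iff_isSimpleModule_asModule]
  let f : ρ.asModule ≃ₗ[MonoidAlgebra k G] M :=
    { ρ.asModuleEquiv with
      map_smul' := fun x m => (ρ.asModuleEquiv_map_smul x m).trans
        (Representation.asAlgebraHom_ofModule' x _) }
  exact IsSimpleModule.congr f

variable {ι : Type*} {d : ι → ℕ} {φ : ∀ i, G →* Matrix (Fin (d i)) (Fin (d i)) ℂ}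

theorem IsCompleteIrreps.exists_equiv (hφ : IsCompleteIrreps d φ) {V : Type*} [AddCommGroup V]
    [Module ℂ V] [FiniteDimensional ℂ V] (ρ : Representation ℂ G V) (hρ : ρ.IsIrreducible) :
    ∃ i, Nonempty (ρ.Equiv (matRep (φ i))) := by
  let b := Module.finBasis ℂ V
  let σ : G →* Matrix (Fin (Module.finrank ℂ V)) (Fin (Module.finrank ℂ V)) ℂ :=
    ((LinearMap.toMatrixAlgEquiv b : _ ≃ₐ[ℂ] _) : _ →* _).comp ρ
  let f : ρ.Equiv (matRep σ) := Representation.Equiv.mk b.equivFun fun g => by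
    refine LinearMap.ext fun v => ?_
    exact (LinearMap.toMatrix_mulVec_repr b b (ρ g) v).symm
  obtain ⟨i, ⟨e⟩⟩ := hφ.complete _ σ (f.isIrreducible hρ)
  exact ⟨i, ⟨f.trans e⟩⟩

variable [Fintype G]

theorem IsCompleteIrreps.sum_smul_eq_zero (hφ : IsCompleteIrreps d φ) {a : G → ℂ}
    (ha : ∀ i, ∑ g, a g • φ i g = 0) {V : Type*} [AddCommGroup V]
    [Module ℂ V] [FiniteDimensional ℂ V] (ρ : Representation ℂ G V) (hρ : ρ.IsIrreducible) (v : V) :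
    ∑ g, a g • ρ g v = 0 := by
  obtain ⟨i, ⟨e⟩⟩ := hφ.exists_equiv ρ hρ
  apply e.toLinearEquiv.injective
  have h1 : ∀ g, e.toLinearEquiv (ρ g v) = φ i g *ᵥ e.toLinearEquiv v := fun g =>
    Representation.IntertwiningMap.isIntertwining _ _ e.toIntertwiningMap g v
  simp_rw [map_sum, map_smul, h1, map_zero, ← Matrix.smul_mulVec, ← Matrix.sum_mulVec, ha,
    Matrix.zero_mulVec]

theorem IsCompleteIrreps.smul_eq_zero (hφ : IsCompleteIrreps d φ) {a : G → ℂ}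
    (ha : ∀ i, ∑ g, a g • φ i g = 0) {M : Type*} [AddCommGroup M] [Module ℂ M]
    [Module (MonoidAlgebra ℂ G) M] [IsScalarTower ℂ (MonoidAlgebra ℂ G) M]
    [IsSimpleModule (MonoidAlgebra ℂ G) M] (m : M) :
    (∑ g, MonoidAlgebra.single g (a g) : MonoidAlgebra ℂ G) • m = 0 := by
  have : Module.Finite ℂ (MonoidAlgebra ℂ G) := Module.Finite.of_basis (MonoidAlgebra.basis G ℂ)
  have : Module.Finite ℂ M := Module.Finite.trans (MonoidAlgebra ℂ G) M
  rw [← hφ.sum_smul_eq_zero ha (Representation.ofModule' M) Representation.isIrreducible_ofModule' m,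
    ← Representation.asAlgebraHom_ofModule', map_sum, LinearMap.sum_apply]
  simp [Representation.asAlgebraHom_single]

/-- The element `∑ a g • g` kills every simple module, so it lies in the Jacobson radical of `ℂ[G]`,
which is zero by semisimplicity. -/
theorem IsCompleteIrreps.eq_zero (hφ : IsCompleteIrreps d φ) {a : G → ℂ}
    (ha : ∀ i, ∑ g, a g • φ i g = 0) : a = 0 := by
  have hx : (∑ g, MonoidAlgebra.single g (a g)) ∈ Ring.jacobson (MonoidAlgebra ℂ G) := by
    rw [Ring.jacobson_eq_sInf_isMaximal, Submodule.mem_sInf]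
    intro I hI
    have hs : IsSimpleModule (MonoidAlgebra ℂ G) (MonoidAlgebra ℂ G ⧸ I) :=
      isSimpleModule_iff_isCoatom.2 (Ideal.IsMaximal.out (self := hI))
    have h1 := hφ.smul_eq_zero ha (Submodule.Quotient.mk 1 : MonoidAlgebra ℂ G ⧸ I)
    rwa [← Submodule.Quotient.mk_smul, smul_eq_mul, mul_one, Submodule.Quotient.mk_eq_zero] at h1
  rw [IsSemisimpleRing.jacobson_eq_bot, Submodule.mem_bot] at hx
  classical
  funext g
  have := congrArg (fun y : MonoidAlgebra ℂ G => y.coeff g) hx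
  simpa [Finsupp.single_apply, MonoidAlgebra.coeff_sum] using this

theorem IsCompleteIrreps.card_eq [Fintype ι] (hφ : IsCompleteIrreps d φ) :
    Fintype.card (Σ i, Fin (d i) × Fin (d i)) = Fintype.card G := by
  apply le_antisymm
  · simpa using hφ.linearIndependent_coeffMatrix.fintype_card_le_finrank
  · have h : LinearIndependent ℂ (coeffMatrix φ).col := by
      rw [Fintype.linearIndependent_iff]
      intro a ha
      refine congrFun (hφ.eq_zero (a := a) fun i => ?_)
      ext k l
      simpa [coeffMatrix, Matrix.sum_apply] using congrFun ha ⟨i, k, l⟩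
    simpa using h.fintype_card_le_finrank

theorem extendRep_generalElement {n : ℕ} (ψ : G →* Matrix (Fin n) (Fin n) ℂ) (k l : Fin n) :
    extendRep ψ (generalElement G) k l = ∑ g, MvPolynomial.X g * MvPolynomial.C (ψ g k l) := by
  simp [extendRep, generalElement, Matrix.sum_apply]

/-- Frobenius's factorization of the group determinant. -/
theorem IsCompleteIrreps.groupDet_eq_prod [DecidableEq G] [Fintype ι] (hφ : IsCompleteIrreps d φ) :
    groupDet G = ∏ i, (extendRep (φ i) (generalElement G)).det ^ d i := by
  classical
  -- Multiplication mixes only the row index of a coefficient; the inert column index gives the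
  -- factor `1` and hence the exponent `d i`.
  let D : Matrix (Σ i, Fin (d i) × Fin (d i)) (Σ i, Fin (d i) × Fin (d i)) (PolyRing G) :=
    Matrix.blockDiagonal' fun i =>
      Matrix.kronecker (extendRep (φ i) (generalElement G)) (1 : Matrix (Fin (d i)) (Fin (d i)) _)
  have hD : D.det = ∏ i, (extendRep (φ i) (generalElement G)).det ^ d i := by
    simp [D, Matrix.det_blockDiagonal', Matrix.det_kronecker]
  rw [← hD]
  refine Matrix.det_eq_det_of_mul_eq_mul MvPolynomial.C hφ.card_eq
    hφ.linearIndependent_coeffMatrix ?_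
  ext1 ⟨i, k, l⟩ h
  have hR : (D * (coeffMatrix φ).map (MvPolynomial.C : ℂ →+* PolyRing G) : Matrix _ _ _) ⟨i, k, l⟩ h =
      ∑ m, extendRep (φ i) (generalElement G) k m * MvPolynomial.C (φ i h m l) := by
    rw [Matrix.mul_apply, Fintype.sum_sigma, Finset.sum_eq_single i]
    · simp [D, coeffMatrix, Fintype.sum_prod_type, Matrix.one_apply]
    · intro j _ hj
      refine Finset.sum_eq_zero fun x _ => ?_
      simp [D, Matrix.blockDiagonal'_apply_ne _ _ _ hj.symm]
    · simp
  rw [hR, Matrix.mul_apply]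
  simp_rw [extendRep_generalElement, Finset.sum_mul]
  rw [Finset.sum_comm]
  refine Fintype.sum_equiv (Equiv.mulRight h⁻¹) _ _ fun g => ?_
  have h1 : φ i g k l = ∑ m, φ i (g * h⁻¹) k m * φ i h m l := by
    rw [← Matrix.mul_apply, ← map_mul, inv_mul_cancel_right]
  simp [coeffMatrix, h1, mul_assoc, mul_comm (MvPolynomial.X _), Finset.sum_mul]

end Frobenius

/-! ### Norms, characters and twists -/

section Norm

/-- Transitivity of determinants under restriction of scalars; as `B` is commutative, passing to
`Bᵐᵒᵖ` does not change the norm. -/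
theorem norm_studyDet {R A B κ : Type*} [CommRing R] [CommRing B] [Ring A] [Algebra R B]
    [Module.Free R B] [Algebra R A] [Module Bᵐᵒᵖ A] [IsScalarTower R Bᵐᵒᵖ A]
    [SMulCommClass Bᵐᵒᵖ A A] [Fintype κ] [DecidableEq κ] (e : Module.Basis κ Bᵐᵒᵖ A) (a : A) :
    Algebra.norm R (studyDet e !![a]) = LinearMap.det (LinearMap.mulLeft R a) := by
  have : Module.Free Bᵐᵒᵖ A := Module.Free.of_basis e
  let f : A →ₗ[Bᵐᵒᵖ] A :=
    { toFun := fun x => a * x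
      map_add' := mul_add a
      map_smul' := fun b x => (smul_comm b a x).symm }
  have h1 : LinearMap.det f = MulOpposite.op (studyDet e !![a]) := by
    let φ : B ≃+* Bᵐᵒᵖ := RingEquiv.toOpposite B
    change _ = φ _
    rw [studyDet, RingEquiv.map_det, ← LinearMap.det_toMatrix e,
      ← Matrix.det_submatrix_equiv_self (Equiv.prodUnique κ (Fin 1)).symm]
    congr 1
    ext i j
    simp [LinearMap.toMatrix_apply, leftRegular, f, φ]
  have h2 : f.restrictScalars R = LinearMap.mulLeft R a := rfl
  rw [← h2, LinearMap.det_restrictScalars, h1]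
  exact (Algebra.norm_eq_of_algEquiv (AlgEquiv.toOpposite R B) _).symm

variable {G : Type*} [Group G]

theorem det_mulLeft_generalElement [Fintype G] [DecidableEq G] :
    LinearMap.det (LinearMap.mulLeft (PolyRing G) (generalElement G)) = groupDet G := by
  rw [← LinearMap.det_toMatrix (MonoidAlgebra.basis G (PolyRing G)), groupDet]
  congr 1
  ext1 g h
  have h1 : generalElement G * MonoidAlgebra.single h 1 =
      ∑ x : G, MonoidAlgebra.single (x * h) (MvPolynomial.X x : PolyRing G) := by
    simp [generalElement, Finset.sum_mul, MonoidAlgebra.single_mul_single]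
  have h2 : ((MonoidAlgebra.basis G (PolyRing G)).repr
      (generalElement G * MonoidAlgebra.single h 1)) g = MvPolynomial.X (g * h⁻¹) := by
    change (generalElement G * MonoidAlgebra.single h 1).coeff g = _
    rw [h1, MonoidAlgebra.coeff_sum, Finsupp.finsetSum_apply, Finset.sum_eq_single (g * h⁻¹)]
    · simp
    · intro x _ hx
      rw [MonoidAlgebra.coeff_single, Finsupp.single_apply, if_neg]
      rintro rfl
      simp at hx
    · simp
  simpa [LinearMap.toMatrix_apply] using h2

variable (H : Subgroup G)

theorem extendChar_single {H : Subgroup G} (χ : H →* ℂˣ) (h : H) (c : PolyRing G) :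
    extendChar χ (MonoidAlgebra.single h c) = c * MvPolynomial.C (χ h : ℂ) := by
  simp [extendChar]

theorem extendChar_eq_sum {H : Subgroup G} [Fintype H] (χ : H →* ℂˣ) (b : PolyGroupAlg G H) :
    extendChar χ b = ∑ h, MvPolynomial.C (χ h : ℂ) * b.coeff h := by
  classical
  induction b using MonoidAlgebra.induction_linear with
  | zero => simp
  | add f g hf hg => simp [hf, hg, mul_add, Finset.sum_add_distrib]
  | single k r => simp [extendChar_single, Finsupp.single_apply, mul_comm]

theorem twistChar_add {H : Subgroup G} (χ : H →* ℂˣ) (a b : PolyGroupAlg G H) :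
    twistChar χ (a + b) = twistChar χ a + twistChar χ b := by
  simp only [twistChar, MonoidAlgebra.coeff_add]
  exact Finsupp.sum_add_index' (by simp) (by simp [mul_add])

theorem extendChar_twistChar {H : Subgroup G} (ψ χ : H →* ℂˣ) (b : PolyGroupAlg G H) :
    extendChar ψ (twistChar χ b) = extendChar (ψ * χ) b := by
  induction b using MonoidAlgebra.induction_linear with
  | zero => simp [twistChar]
  | add f g hf hg => rw [twistChar_add, map_add, map_add, hf, hg]
  | single k r =>
    rw [twistChar, MonoidAlgebra.coeff_single, Finsupp.sum_single_index (by simp),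
      extendChar_single, extendChar_single]
    simp
    ring

/-- The character table of `H`. -/
def charTable (H : Type*) [Group H] : Matrix (H →* ℂˣ) H ℂ :=
  Matrix.of fun χ h => (χ h : ℂ)

/-- Dedekind's independence of characters. -/
theorem linearIndependent_charTable (H : Type*) [Group H] :
    LinearIndependent ℂ (charTable H).row :=
  (linearIndependent_monoidHom H ℂ).comp (fun χ : H →* ℂˣ => (Units.coeHom ℂ).comp χ)
    fun _ _ h => MonoidHom.ext fun x => Units.ext (DFunLike.congr_fun h x)

theorem card_characters (H : Type*) [Group H] [IsMulCommutative H] [Fintype H]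
    [Fintype (H →* ℂˣ)] : Fintype.card (H →* ℂˣ) = Fintype.card H := by
  let _ : CommGroup H := { (inferInstance : Group H) with mul_comm := mul_comm' }
  have : NeZero (Monoid.exponent H) := ⟨Monoid.exponent_ne_zero_of_finite⟩
  simpa using CommGroup.card_monoidHom_of_hasEnoughRootsOfUnity H ℂ

variable [IsMulCommutative H] [Finite G] [Fintype (H →* ℂˣ)]

/-- Since `χ(b h) = χ(b) χ(h)`, each row of the character table is a left eigenvector of
multiplication by `b`, with eigenvalue `χ(b)`. -/
theorem norm_eq_prod_extendChar (b : PolyGroupAlg G H) :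
    Algebra.norm (PolyRing G) b = ∏ χ : H →* ℂˣ, extendChar χ b := by
  classical
  have : Fintype H := Fintype.ofFinite H
  rw [Algebra.norm_eq_matrix_det (MonoidAlgebra.basis H (PolyRing G)), ← Matrix.det_diagonal]
  refine Matrix.det_eq_det_of_mul_eq_mul MvPolynomial.C (card_characters H)
    (linearIndependent_charTable H) ?_
  ext1 χ h
  have h1 : ∑ g, MvPolynomial.C (χ g : ℂ) * (b * MonoidAlgebra.single h 1).coeff g =
      extendChar χ b * MvPolynomial.C (χ h : ℂ) := by
    rw [← extendChar_eq_sum, map_mul, extendChar_single, one_mul]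
  rw [Matrix.diagonal_mul, Matrix.mul_apply]
  refine Eq.trans (Finset.sum_congr rfl fun g _ => ?_) h1
  rw [Algebra.leftMulMatrix_apply, LinearMap.toMatrix_apply, MonoidAlgebra.basis_apply]
  rfl

theorem eq_of_forall_extendChar_eq {a b : PolyGroupAlg G H}
    (h : ∀ χ : H →* ℂˣ, extendChar χ a = extendChar χ b) : a = b := by
  have : Fintype H := Fintype.ofFinite H
  apply MonoidAlgebra.ext
  apply DFunLike.coe_injective
  refine Matrix.mulVec_map_injective (MvPolynomial.C : ℂ →+* PolyRing G) (card_characters H)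
    (linearIndependent_charTable H) (funext fun χ => ?_)
  have h1 := h χ
  rwa [extendChar_eq_sum, extendChar_eq_sum] at h1

/-- Applying `ψ` to the `χ`-twist of `b` gives `(ψ * χ)(b)`, so `ψ` only permutes the factors. -/
theorem prod_twistChar (b : PolyGroupAlg G H) :
    ∏ χ : H →* ℂˣ, twistChar χ b =
      algebraMap (PolyRing G) (PolyGroupAlg G H) (∏ χ : H →* ℂˣ, extendChar χ b) := by
  refine eq_of_forall_extendChar_eq H fun ψ => ?_
  rw [AlgHom.commutes, Algebra.algebraMap_self_apply, map_prod]
  simp_rw [extendChar_twistChar]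
  exact Fintype.prod_equiv (Equiv.mulLeft ψ) _ _ fun _ => rfl

end Norm

/-! ### The norm of `Θ(G:H)` and the conclusion -/

section StudyGroupDeterminant

variable {G : Type*} [Group G] (H : Subgroup G)

theorem subgroupAlgIncl_single (h : H) (c : PolyRing G) :
    subgroupAlgIncl H (MonoidAlgebra.single h c) = MonoidAlgebra.single (h : G) c := by
  simp [subgroupAlgIncl]

theorem subgroupAlgIncl_algebraMap (c : PolyRing G) :
    subgroupAlgIncl H (algebraMap (PolyRing G) (PolyGroupAlg G H) c) =
      c • (1 : PolyGroupAlg G G) := by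
  have h : algebraMap (PolyRing G) (PolyGroupAlg G H) c = MonoidAlgebra.single 1 c := rfl
  rw [h, subgroupAlgIncl_single, MonoidAlgebra.one_def, MonoidAlgebra.smul_single]
  simp

theorem norm_studyDet_generalElement [Fintype G] [DecidableEq G] [IsMulCommutative H]
    {κ : Type*} [Fintype κ] [DecidableEq κ]
    (e : Module.Basis κ (PolyGroupAlg G H)ᵐᵒᵖ (PolyGroupAlg G G)) :
    Algebra.norm (PolyRing G) (studyDet e !![generalElement G]) = groupDet G := by
  have : Module.Free (PolyRing G) (PolyGroupAlg G H) :=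
    Module.Free.of_basis (MonoidAlgebra.basis H (PolyRing G))
  have : IsScalarTower (PolyRing G) (PolyGroupAlg G H)ᵐᵒᵖ (PolyGroupAlg G G) :=
    IsScalarTower.of_algebraMap_smul fun r x => by
      change x * subgroupAlgIncl H (algebraMap (PolyRing G) (PolyGroupAlg G H) r) = r • x
      rw [subgroupAlgIncl_algebraMap, mul_smul_comm, mul_one]
  have : SMulCommClass (PolyGroupAlg G H)ᵐᵒᵖ (PolyGroupAlg G G) (PolyGroupAlg G G) :=
    ⟨fun b a x => mul_assoc a x (subgroupAlgIncl H b.unop)⟩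
  rw [norm_studyDet, det_mulLeft_generalElement]

end StudyGroupDeterminant

theorem theorem9p3 {G : Type*} [Group G] [Fintype G] [DecidableEq G]
    (H : Subgroup G) [IsMulCommutative H] [Fintype (H →* ℂˣ)]
    {ι : Type*} [Fintype ι] (d : ι → ℕ)
    (φ : ∀ i, G →* Matrix (Fin (d i)) (Fin (d i)) ℂ) (hφ : IsCompleteIrreps d φ)
    {κ : Type*} [Fintype κ] [DecidableEq κ]
    (e : Module.Basis κ (PolyGroupAlg G H)ᵐᵒᵖ (PolyGroupAlg G G)) :
    let Θ : PolyGroupAlg G H := studyDet e !![generalElement G]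
    groupDet G • (1 : PolyGroupAlg G G) =
        subgroupAlgIncl H (∏ i, ((extendRep (φ i) (generalElement G)).map
          (algebraMap (PolyRing G) (PolyGroupAlg G H))).det ^ d i) ∧
      groupDet G • (1 : PolyGroupAlg G G) =
        subgroupAlgIncl H (∏ χ : H →* ℂˣ,
          algebraMap (PolyRing G) (PolyGroupAlg G H) (extendChar χ Θ)) ∧
      groupDet G • (1 : PolyGroupAlg G G) =
        subgroupAlgIncl H (∏ χ : H →* ℂˣ, twistChar χ Θ) := by
  intro Θ
  have hΘ : ∏ χ : H →* ℂˣ, extendChar χ Θ = groupDet G := by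
    rw [← norm_eq_prod_extendChar, norm_studyDet_generalElement]
  refine ⟨?_, ?_, ?_⟩
  · have h : ∀ i, ((extendRep (φ i) (generalElement G)).map
        (algebraMap (PolyRing G) (PolyGroupAlg G H))).det =
        algebraMap (PolyRing G) (PolyGroupAlg G H) (extendRep (φ i) (generalElement G)).det :=
      fun i => (RingHom.map_det _ _).symm
    simp_rw [h, ← map_pow]
    rw [← map_prod, ← hφ.groupDet_eq_prod, subgroupAlgIncl_algebraMap]
  · rw [← map_prod, hΘ, subgroupAlgIncl_algebraMap]
  · rw [prod_twistChar, hΘ, subgroupAlgIncl_algebraMap]
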